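/- Let $\mathcal K_n$ be the set of all compact convex subsets of $\mathbb R^n$ with nonempty interior, endowed with the Hausdorff metric. A map $p:\mathcal K_n\to\mathbb R^n$ is an affine invariant point if it is continuous and $p(T(K))=T(p(K))$ for every $K\in\mathcal K_n$ and every nonsingular affine map $T:\mathbb R^n\to\mathbb R^n$; it is proper if moreover $p(K)\in\operatorname{int}(K)$ for every $K\in\mathcal K_n$. For $K\in\mathcal K_n$ and $x\in\operatorname{int}(K)$ let $$K^x=x+\{y\in\mathbb R^n:\langle a-x,y\rangle\le 1\text{ for all }a\in K\}\in\mathcal K_n$$ be the polar body of $K$ with respect to $x$. If $p$ is a proper affine invariant point, an affine invariant point $q$ is called a dual of $p$ if $q(K^{p(K)})=p(K)$ for all $K\in\mathcal K_n$; if $p$ has exactly one dual, it is denoted by $p^\circ$. Let $g(K)=\frac1{|K|}\int_K x\,dx$ be the centroid of $K$. Then for every $K\in\mathcal K_n$ the function $x\mapsto|K^x|$ (volume) on $\operatorname{int}(K)$ attains its minimum at exactly one point $s(K)\in\operatorname{int}(K)$, the Santaló point of $K$. Both $s:K\mapsto s(K)$ and $g:K\mapsto g(K)$ are proper affine invariant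 points, and they are dual to each other: $s$ has exactly one dual, and it is the centroid, $s^\circ=g$; and $g$ has exactly one dual, and it is the Santaló point, $g^\circ=s$. In particular $g(K^{s(K)})=s(K)$ and $s(K^{g(K)})=g(K)$ for all $K\in\mathcal K_n$. -/

import Mathlib

open MeasureTheory

noncomputable section

namespace AffineInvariantPoints

/-- Euclidean space `ℝⁿ` with its canonical scalar product. -/
abbrev E (n : ℕ) : Type := EuclideanSpace ℝ (Fin n)

/-- The set `𝒦ₙ` of convex compact subsets of `ℝⁿ` with nonempty interior. As a subtype of
Mathlib's `ConvexBody` it carries the Hausdorff metric. -/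
abbrev Body (n : ℕ) : Type :=
  {K : ConvexBody (E n) // (interior (K : Set (E n))).Nonempty}

/-- The underlying set of an element of `𝒦ₙ`. -/
def Body.set {n : ℕ} (K : Body n) : Set (E n) := (K.1 : Set (E n))

/-- The image `T(K)` of a convex body under a nonsingular affine map `T`. -/
def Body.image {n : ℕ} (T : E n ≃ᵃ[ℝ] E n) (K : Body n) : Body n :=
  ⟨{ carrier := T '' K.set
     convex' := K.1.convex.affine_image (T : E n →ᵃ[ℝ] E n)
     isCompact' := K.1.isCompact.image (T : E n →ᵃ[ℝ] E n).continuous_of_finiteDimensional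
     nonempty' := K.1.nonempty.image T }, by
    have h := T.toContinuousAffineEquiv.toHomeomorph.image_interior K.set
    exact (K.2.image T.toContinuousAffineEquiv.toHomeomorph).mono h.subset⟩

/-- The polar set `A° = {y | ⟨a, y⟩ ≤ 1 for all a ∈ A}`. -/
def polarSet {n : ℕ} (A : Set (E n)) : Set (E n) := {y | ∀ a ∈ A, inner ℝ a y ≤ 1}

/-- The polar `Aˣ = (A - x)° + x` of `A` with respect to the point `x`. -/
def polarAt {n : ℕ} (A : Set (E n)) (x : E n) : Set (E n) :=
  (fun y => y + x) '' polarSet ((fun a => a - x) '' A)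

theorem mem_polarAt {n : ℕ} {A : Set (E n)} {x y : E n} :
    y ∈ polarAt A x ↔ ∀ a ∈ A, inner ℝ (a - x) (y - x) ≤ 1 := by
  constructor
  · rintro ⟨z, hz, rfl⟩ a ha
    simpa using hz _ ⟨a, ha, rfl⟩
  · intro h
    refine ⟨y - x, ?_, by simp⟩
    rintro _ ⟨a, ha, rfl⟩
    exact h a ha

theorem convex_polarAt {n : ℕ} (A : Set (E n)) (x : E n) : Convex ℝ (polarAt A x) := by
  intro y hy z hz s t hs ht hst
  rw [mem_polarAt] at *
  intro a ha
  have e : s • y + t • z - x = s • (y - x) + t • (z - x) := by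
    have : x = (s + t) • x := by rw [hst, one_smul]
    nth_rewrite 1 [this]
    module
  rw [e, inner_add_right, inner_smul_right, inner_smul_right]
  nlinarith [hy a ha, hz a ha]

theorem isClosed_polarAt {n : ℕ} (A : Set (E n)) (x : E n) : IsClosed (polarAt A x) := by
  have : polarAt A x = ⋂ a ∈ A, {y | inner ℝ (a - x) (y - x) ≤ 1} := by
    ext y; simp [mem_polarAt]
  rw [this]
  exact isClosed_biInter fun a _ => isClosed_le (by fun_prop) continuous_const

theorem isBounded_polarAt {n : ℕ} {A : Set (E n)} {x : E n} (hx : x ∈ interior A) :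
    Bornology.IsBounded (polarAt A x) := by
  obtain ⟨r, hr, hA⟩ := Metric.isOpen_iff.1 isOpen_interior x hx
  refine (Metric.isBounded_closedBall (x := x) (r := 2 / r)).subset fun y hy => ?_
  rw [mem_polarAt] at hy
  rw [Metric.mem_closedBall, dist_eq_norm]
  by_cases h0 : ‖y - x‖ = 0
  · rw [h0]; positivity
  have hpos : 0 < ‖y - x‖ := lt_of_le_of_ne (norm_nonneg _) (Ne.symm h0)
  have hmem : x + (r / 2 / ‖y - x‖) • (y - x) ∈ A := by
    refine interior_subset (hA ?_)
    rw [Metric.mem_ball, dist_eq_norm, add_sub_cancel_left, norm_smul, Real.norm_eq_abs,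
      abs_of_pos (by positivity), div_mul_cancel₀ _ h0]
    linarith
  have h := hy _ hmem
  rw [add_sub_cancel_left, real_inner_smul_left, real_inner_self_eq_norm_sq] at h
  have h2 : r / 2 / ‖y - x‖ * ‖y - x‖ ^ 2 = r / 2 * ‖y - x‖ := by field_simp
  rw [h2] at h
  rw [le_div_iff₀ hr]
  linarith

theorem mem_interior_polarAt {n : ℕ} {A : Set (E n)} {x : E n} (hA : Bornology.IsBounded A) :
    x ∈ interior (polarAt A x) := by
  obtain ⟨R, hR, hAR⟩ := hA.subset_closedBall_lt 0 x
  refine mem_interior.2 ⟨Metric.ball x (1 / R), fun y hy => ?_, Metric.isOpen_ball,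
    Metric.mem_ball_self (by positivity)⟩
  rw [mem_polarAt]
  intro a ha
  have h1 : ‖a - x‖ ≤ R := by simpa [dist_eq_norm] using hAR ha
  have h2 : ‖y - x‖ ≤ 1 / R := by
    rw [← dist_eq_norm]; exact (Metric.mem_ball.1 hy).le
  calc inner ℝ (a - x) (y - x) ≤ ‖a - x‖ * ‖y - x‖ := real_inner_le_norm _ _
    _ ≤ R * (1 / R) := by gcongr
    _ = 1 := by field_simp

/-- The polar body `Kˣ ∈ 𝒦ₙ` of `K ∈ 𝒦ₙ` with respect to `x ∈ int K`. -/
def Body.polar {n : ℕ} (K : Body n) (x : E n) (hx : x ∈ interior K.set) : Body n :=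
  ⟨{ carrier := polarAt K.set x
     convex' := convex_polarAt _ _
     isCompact' := Metric.isCompact_of_isClosed_isBounded (isClosed_polarAt _ _)
       (isBounded_polarAt hx)
     nonempty' := ⟨x, interior_subset (mem_interior_polarAt K.1.isBounded)⟩ },
    ⟨x, mem_interior_polarAt K.1.isBounded⟩⟩

/-- `p : 𝒦ₙ → ℝⁿ` is an affine invariant point: it is continuous for the Hausdorff metric and
commutes with all nonsingular affine maps. -/
structure IsAffineInvariantPoint {n : ℕ} (p : Body n → E n) : Prop where
  continuous : Continuous p
  map_image : ∀ (T : E n ≃ᵃ[ℝ] E n) (K : Body n), p (K.image T) = T (p K)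

/-- `p` is a proper affine invariant point. -/
structure IsProperAffineInvariantPoint {n : ℕ} (p : Body n → E n) : Prop
    extends IsAffineInvariantPoint p where
  mem_interior : ∀ K : Body n, p K ∈ interior K.set

/-- `q` is a dual of `p`: `p` is a proper affine invariant point, `q` is an affine invariant point
and `q (K^{p(K)}) = p(K)` for every `K ∈ 𝒦ₙ`. -/
structure IsDual {n : ℕ} (p q : Body n → E n) : Prop where
  proper : IsProperAffineInvariantPoint p
  affineInvariant : IsAffineInvariantPoint q
  apply_polar : ∀ K : Body n, q (K.polar (p K) (proper.mem_interior K)) = p K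

/-- `p° = q`: `q` is the unique dual of `p`. -/
def IsTheDual {n : ℕ} (p q : Body n → E n) : Prop :=
  IsDual p q ∧ ∀ q' : Body n → E n, IsDual p q' → q' = q

/-- The centroid `g(K) = (∫_K x dx) / |K|`. -/
def centroid {n : ℕ} (K : Body n) : E n :=
  (volume.real K.set)⁻¹ • ∫ x in K.set, x

/-- `x ∈ int K` minimizes the volume `|Kˣ|` of the polar body over the interior of `K`. -/
def IsSantaloPoint {n : ℕ} (K : Body n) (x : E n) : Prop :=
  x ∈ interior K.set ∧
    ∀ y ∈ interior K.set, volume (polarAt K.set x) ≤ volume (polarAt K.set y)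

open Classical in
/-- The Santaló point `s(K)`: the point of `int K` at which `|Kˣ|` is minimal. -/
def santaloPoint {n : ℕ} (K : Body n) : E n :=
  if h : ∃ x, IsSantaloPoint K x then h.choose else 0

end AffineInvariantPoints

end

/-!
Write `h_K` for the support function of `K`. For `x ∈ K` the set `Kˣ - x = (K - x)°` is the sublevel
set `{h_K - ⟨x, ·⟩ ≤ 1}` of a positively homogeneous function, and the layer cake formula
(`lintegral_mul_exp_neg`) turns integrals of homogeneous functions over it into integrals over the
whole space: `n! |Kˣ| = ∫ exp (⟨x, y⟩ - h_K(y)) dy`, and the first moments of `(K - x)°` are, up to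
the factor `(n + 1)!`, the integrals `∫ ⟨v, y⟩ exp (⟨x, y⟩ - h_K(y)) dy`.

In this form the volume of the polar is visibly a strictly convex function of `x ∈ int K` whose
gradient is, up to a constant, the first moment of `(K - x)°`. It is lower semicontinuous on `K` and
infinite on the boundary (`mem_interior_of_integrable_weight`), so it has a minimum in the interior.
The minimum is unique, and it is the only critical point. Hence `x ∈ int K` is the Santaló point of
`K` if and only if `x` is the centroid of `Kˣ` (`isSantaloPoint_iff_centroid`).

Together with the bipolar theorem `(Kˣ)ˣ = K` this equivalence contains the duality: it gives
`s(K) = x ↔ g(Kˣ) = x` and `g(K) = x ↔ s(Kˣ) = x`. It also shows that every body has the form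
`L^{s(L)}`, as well as `L^{g(L)}`, so duals are unique (`isTheDual_of_forall_iff`).

Continuity of the centroid is dominated convergence for indicator functions. Continuity of the
Santaló point follows from joint continuity of `∫ exp (⟨x, y⟩ - h_K(y)) dy` in `(K, x)` and its
convexity in `x` (`continuous_santaloPoint`).
-/

noncomputable section

namespace AffineInvariantPoints

open Filter Topology Set
open scoped RealInnerProductSpace

/-! ### Layer cake formula for homogeneous functions -/

theorem lintegral_comp_smul_eq {n : ℕ} (f : E n → ENNReal) (hf : Measurable f) {t : ℝ}
    (ht : 0 < t) : ∫⁻ y, f y = ENNReal.ofReal (t ^ n) * ∫⁻ z, f (t • z) := by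
  have h := Measure.map_addHaar_smul (volume : Measure (E n)) ht.ne'
  rw [← lintegral_map hf (measurable_const_smul t), h, lintegral_smul_measure, smul_eq_mul,
    ← mul_assoc, ← ENNReal.ofReal_mul (by positivity), finrank_euclideanSpace_fin,
    abs_of_pos (by positivity), mul_inv_cancel₀ (by positivity), ENNReal.ofReal_one, one_mul]

theorem lintegral_Ioi_pow_mul_exp_neg (m : ℕ) :
    ∫⁻ t in Ioi (0 : ℝ), ENNReal.ofReal (t ^ m * Real.exp (-t)) =
      ENNReal.ofReal (Nat.factorial m) := by
  have hp : (0 : ℝ) < m + 1 := by positivity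
  have hi := Real.GammaIntegral_convergent hp
  have h := Real.Gamma_eq_integral hp
  simp only [add_sub_cancel_right, Real.rpow_natCast, Real.Gamma_nat_eq_factorial] at h hi
  rw [h, ofReal_integral_eq_lintegral_ofReal hi]
  · simp only [mul_comm]
  · filter_upwards [self_mem_ae_restrict measurableSet_Ioi] with t ht
    have : (0 : ℝ) < t := ht
    positivity

theorem lintegral_indicator_exp_neg {s : ℝ} (hs : 0 ≤ s) :
    ∫⁻ t in Ioi (0 : ℝ), (Ici s).indicator (fun t => ENNReal.ofReal (Real.exp (-t))) t =
      ENNReal.ofReal (Real.exp (-s)) := by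
  rw [lintegral_indicator measurableSet_Ici, Measure.restrict_restrict measurableSet_Ici,
    ← integral_exp_neg_Ioi s, ofReal_integral_eq_lintegral_ofReal
      (integrableOn_exp_neg_Ioi s) (ae_of_all _ fun _ => (Real.exp_pos _).le)]
  rcases hs.eq_or_lt with rfl | hs
  · have h : Ici (0 : ℝ) ∩ Ioi 0 = Ioi 0 := inter_eq_right.2 Ioi_subset_Ici_self
    rw [h]
  · have h : Ici s ∩ Ioi 0 = Ici s := inter_eq_left.2 fun x hx => hs.trans_le hx
    rw [h]
    exact setLIntegral_congr Ioi_ae_eq_Ici.symm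

/-- Integrating a positively homogeneous function `G` of degree `k` against `exp (-φ)`, where `φ`
is nonnegative and positively homogeneous of degree one, amounts to integrating `G` over the
sublevel set `{φ ≤ 1}`. This is Tonelli's theorem applied to `exp (-φ) = ∫_φ^∞ exp (-t) dt`,
followed by the scaling `{φ ≤ t} = t {φ ≤ 1}`. -/
theorem lintegral_mul_exp_neg {n k : ℕ} {φ : E n → ℝ} (hφ : Measurable φ) (hφ0 : ∀ y, 0 ≤ φ y)
    (hφs : ∀ t : ℝ, 0 < t → ∀ y, φ (t • y) = t * φ y) {G : E n → ENNReal} (hG : Measurable G)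
    (hGs : ∀ t : ℝ, 0 < t → ∀ y, G (t • y) = ENNReal.ofReal (t ^ k) * G y) :
    ∫⁻ y, G y * ENNReal.ofReal (Real.exp (-φ y)) =
      ENNReal.ofReal (Nat.factorial (n + k)) * ∫⁻ y in {y | φ y ≤ 1}, G y := by
  have hm : MeasurableSet {p : E n × ℝ | φ p.1 ≤ p.2} :=
    measurableSet_le (hφ.comp measurable_fst) measurable_snd
  have hm1 : ∀ t : ℝ, MeasurableSet {y | φ y ≤ t} := fun t => measurableSet_le hφ measurable_const
  have hH : Measurable (fun p : E n × ℝ => {p : E n × ℝ | φ p.1 ≤ p.2}.indicator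
      (fun p => G p.1 * ENNReal.ofReal (Real.exp (-p.2))) p) := by
    refine Measurable.indicator ?_ hm
    fun_prop
  calc ∫⁻ y, G y * ENNReal.ofReal (Real.exp (-φ y))
      = ∫⁻ y, ∫⁻ t in Ioi (0 : ℝ), {p : E n × ℝ | φ p.1 ≤ p.2}.indicator
          (fun p => G p.1 * ENNReal.ofReal (Real.exp (-p.2))) (y, t) := by
        refine lintegral_congr fun y => ?_
        rw [← lintegral_indicator_exp_neg (hφ0 y), ← lintegral_const_mul]
        · refine lintegral_congr fun t => ?_
          by_cases h : φ y ≤ t <;> simp [indicator, h]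
        · exact Measurable.indicator (by fun_prop) measurableSet_Ici
    _ = ∫⁻ t in Ioi (0 : ℝ), ∫⁻ y, {p : E n × ℝ | φ p.1 ≤ p.2}.indicator
          (fun p => G p.1 * ENNReal.ofReal (Real.exp (-p.2))) (y, t) :=
        lintegral_lintegral_swap hH.aemeasurable
    _ = ∫⁻ t in Ioi (0 : ℝ), ENNReal.ofReal (t ^ (n + k) * Real.exp (-t)) *
          ∫⁻ y in {y | φ y ≤ 1}, G y := by
        refine setLIntegral_congr_fun measurableSet_Ioi fun t (ht : 0 < t) => ?_
        have hHt : Measurable fun y => {p : E n × ℝ | φ p.1 ≤ p.2}.indicator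
          (fun p => G p.1 * ENNReal.ofReal (Real.exp (-p.2))) (y, t) :=
          hH.comp measurable_prodMk_right
        rw [lintegral_comp_smul_eq _ hHt ht, pow_add, mul_assoc, ENNReal.ofReal_mul (by positivity),
          mul_assoc, ← lintegral_indicator (hm1 1), ← lintegral_const_mul _ (hG.indicator (hm1 1))]
        congr 1
        refine lintegral_congr fun y => ?_
        have h1 : t * φ y ≤ t ↔ φ y ≤ 1 := by
          constructor <;> intro h <;> nlinarith
        simp only [indicator, mem_ofPred_eq, hφs t ht, h1, hGs t ht]
        split_ifs
        · rw [ENNReal.ofReal_mul (by positivity)]; ring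
        · simp
    _ = _ := by
        rw [lintegral_mul_const _ (by fun_prop), lintegral_Ioi_pow_mul_exp_neg]

theorem integrable_exp_neg_mul_norm {n : ℕ} {c : ℝ} (hc : 0 < c) :
    Integrable (fun y : E n => Real.exp (-(c * ‖y‖))) := by
  refine ⟨by fun_prop, ?_⟩
  rw [hasFiniteIntegral_iff_ofReal (ae_of_all _ fun _ => (Real.exp_pos _).le)]
  have h := lintegral_mul_exp_neg (n := n) (k := 0) (φ := fun y => c * ‖y‖) (G := fun _ => 1)
    (by fun_prop) (fun y => by positivity)
    (fun t ht y => by rw [norm_smul, Real.norm_eq_abs, abs_of_pos ht]; ring) (by fun_prop)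
    (by simp)
  simp only [one_mul, lintegral_const, Measure.restrict_apply_univ] at h
  rw [h]
  refine ENNReal.mul_lt_top ENNReal.ofReal_lt_top ?_
  refine lt_of_le_of_lt (measure_mono fun y (hy : c * ‖y‖ ≤ 1) => ?_)
    (measure_closedBall_lt_top (x := (0 : E n)) (r := 1 / c))
  rw [mem_closedBall_zero_iff, le_div_iff₀ hc]; linarith

variable {n : ℕ}

/-! ### Support functions -/

/-- The support function `h_K(y) = max {⟨a, y⟩ | a ∈ K}` of a convex body. -/
def supp (K : Body n) (y : E n) : ℝ := sSup ((fun a => ⟪a, y⟫) '' K.set)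

theorem Body.isCompact (K : Body n) : IsCompact K.set := K.1.isCompact
theorem Body.convex (K : Body n) : Convex ℝ K.set := K.1.convex
theorem Body.isClosed (K : Body n) : IsClosed K.set := K.1.isCompact.isClosed
theorem Body.nonempty (K : Body n) : K.set.Nonempty := K.1.nonempty
theorem Body.nonempty_interior (K : Body n) : (interior K.set).Nonempty := K.2

theorem exists_inner_eq_supp (K : Body n) (y : E n) : ∃ a ∈ K.set, ⟪a, y⟫ = supp K y := by
  obtain ⟨a, ha, h, -⟩ := K.isCompact.exists_sSup_image_eq_and_ge K.nonempty
    (f := fun a => ⟪a, y⟫) (by fun_prop)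
  exact ⟨a, ha, h.symm⟩

theorem inner_le_supp (K : Body n) {a : E n} (ha : a ∈ K.set) (y : E n) : ⟪a, y⟫ ≤ supp K y :=
  le_csSup (K.isCompact.image (f := fun a => ⟪a, y⟫) (by fun_prop)).bddAbove ⟨a, ha, rfl⟩

theorem supp_le_iff (K : Body n) {y : E n} {c : ℝ} :
    supp K y ≤ c ↔ ∀ a ∈ K.set, ⟪a, y⟫ ≤ c := by
  refine ⟨fun h a ha => (inner_le_supp K ha y).trans h, fun h => ?_⟩
  obtain ⟨a, ha, e⟩ := exists_inner_eq_supp K y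
  exact e ▸ h a ha

theorem supp_smul (K : Body n) {t : ℝ} (ht : 0 < t) (y : E n) :
    supp K (t • y) = t * supp K y := by
  refine le_antisymm ((supp_le_iff K).2 fun a ha => ?_) ?_
  · rw [inner_smul_right]
    exact mul_le_mul_of_nonneg_left (inner_le_supp K ha y) ht.le
  · obtain ⟨a, ha, e⟩ := exists_inner_eq_supp K y
    rw [← e, ← inner_smul_right]
    exact inner_le_supp K ha _

theorem supp_add_le (K : Body n) (y z : E n) : supp K (y + z) ≤ supp K y + supp K z :=
  (supp_le_iff K).2 fun a ha => by
    rw [inner_add_right]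
    exact add_le_add (inner_le_supp K ha y) (inner_le_supp K ha z)

theorem exists_mem_dist_lt {K L : Body n} {δ : ℝ} (h : dist K L < δ) {a : E n}
    (ha : a ∈ K.set) : ∃ b ∈ L.set, dist a b < δ :=
  Metric.exists_dist_lt_of_hausdorffDist_lt (s := K.set) (t := L.set) ha h
    ConvexBody.hausdorffEDist_ne_top

theorem supp_le_supp_add {K L : Body n} {δ : ℝ} (h : dist K L < δ) (y : E n) :
    supp K y ≤ supp L y + δ * ‖y‖ := by
  refine (supp_le_iff K).2 fun a ha => ?_
  obtain ⟨b, hb, hab⟩ := exists_mem_dist_lt h ha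
  have h1 : ⟪a - b, y⟫ ≤ δ * ‖y‖ := (real_inner_le_norm _ _).trans
    (mul_le_mul_of_nonneg_right (by rw [← dist_eq_norm]; exact hab.le) (norm_nonneg _))
  rw [inner_sub_left] at h1
  linarith [inner_le_supp L hb y]

theorem continuous_supp_left (y : E n) : Continuous fun K : Body n => supp K y := by
  refine Metric.continuous_iff.2 fun K ε hε => ⟨ε / (‖y‖ + 1), by positivity, fun L hL => ?_⟩
  have hlt : ε / (‖y‖ + 1) * ‖y‖ < ε := by
    rw [div_mul_eq_mul_div, div_lt_iff₀ (by positivity)]; nlinarith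
  have h1 := supp_le_supp_add hL y
  have h2 := supp_le_supp_add (by rwa [dist_comm] at hL) y
  rw [Real.dist_eq, abs_lt]
  constructor <;> linarith

theorem continuous_supp (K : Body n) : Continuous (supp K) := by
  obtain ⟨R, hR⟩ := K.isCompact.isBounded.exists_norm_le
  obtain ⟨a₀, ha₀⟩ := K.nonempty
  have hR0 : 0 ≤ R := (norm_nonneg _).trans (hR a₀ ha₀)
  lift R to NNReal using hR0
  refine (LipschitzWith.of_le_add_mul R fun y z => ?_).continuous
  refine (supp_le_iff K).2 fun a ha => ?_
  have h1 : ⟪a, y - z⟫ ≤ R * dist y z := (real_inner_le_norm _ _).trans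
    (by rw [dist_eq_norm]; exact mul_le_mul_of_nonneg_right (hR a ha) (norm_nonneg _))
  rw [inner_sub_right] at h1
  have := inner_le_supp K ha z
  linarith

/-- A convex body is recovered from its support function, by the Hahn–Banach theorem. -/
theorem mem_of_forall_inner_le_supp (K : Body n) {x : E n} (h : ∀ y, ⟪x, y⟫ ≤ supp K y) :
    x ∈ K.set := by
  by_contra hx
  obtain ⟨f, u, hf, hu⟩ := geometric_hahn_banach_closed_point K.convex K.isClosed hx
  set v := (InnerProductSpace.toDual ℝ (E n)).symm f with hv
  have hfv : ∀ a, f a = ⟪a, v⟫ := fun a => by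
    rw [real_inner_comm, hv, InnerProductSpace.toDual_symm_apply]
  have h1 : supp K v ≤ u := (supp_le_iff K).2 fun a ha => hfv a ▸ (hf a ha).le
  rw [hfv] at hu
  linarith [h v]

/-- A ball `B(x, r) ⊆ K` forces `h_K(y) ≥ ⟨x, y⟩ + r ‖y‖`. -/
theorem inner_add_le_supp {K : Body n} {x : E n} {r : ℝ} (hr : 0 ≤ r)
    (hK : Metric.closedBall x r ⊆ K.set) (y : E n) : ⟪x, y⟫ + r * ‖y‖ ≤ supp K y := by
  rcases eq_or_ne y 0 with rfl | hy
  · obtain ⟨a, -, h⟩ := exists_inner_eq_supp K (0 : E n)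
    simp [← h]
  have hy' : ‖y‖ ≠ 0 := norm_ne_zero_iff.2 hy
  have hmem : x + (r / ‖y‖) • y ∈ K.set := hK <| by
    rw [Metric.mem_closedBall, dist_eq_norm, add_sub_cancel_left, norm_smul, Real.norm_eq_abs,
      abs_of_nonneg (by positivity), div_mul_cancel₀ _ hy']
  have h := inner_le_supp K hmem y
  rw [inner_add_left, real_inner_smul_left, real_inner_self_eq_norm_sq] at h
  have : r / ‖y‖ * ‖y‖ ^ 2 = r * ‖y‖ := by field_simp
  linarith

theorem exists_closedBall_subset {K : Body n} {x : E n} (hx : x ∈ interior K.set) :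
    ∃ r > 0, Metric.closedBall x r ⊆ K.set :=
  Metric.nhds_basis_closedBall.mem_iff.1 (mem_interior_iff_mem_nhds.1 hx)

/-! ### The integral `∫ exp (⟨x, y⟩ - h_K(y)) dy` and its minimum -/

/-- The function `y ↦ exp (⟨x, y⟩ - h_K(y))`, whose integral over `ℝⁿ` is `n! |Kˣ|`. -/
def weight (K : Body n) (x y : E n) : ℝ := Real.exp (-(supp K y - ⟪x, y⟫))

theorem weight_pos (K : Body n) (x y : E n) : 0 < weight K x y := Real.exp_pos _

theorem continuous_weight (K : Body n) (x : E n) : Continuous (weight K x) := by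
  have := continuous_supp K
  unfold weight
  fun_prop

theorem weight_le {K : Body n} {x : E n} {r : ℝ} (hr : 0 ≤ r)
    (hK : Metric.closedBall x r ⊆ K.set) (y : E n) : weight K x y ≤ Real.exp (-(r * ‖y‖)) := by
  have := inner_add_le_supp hr hK y
  exact Real.exp_le_exp.2 (by linarith)

theorem integrable_weight {K : Body n} {x : E n} (hx : x ∈ interior K.set) :
    Integrable (weight K x) := by
  obtain ⟨r, hr, hK⟩ := exists_closedBall_subset hx
  refine (integrable_exp_neg_mul_norm hr).mono' (continuous_weight K x).aestronglyMeasurable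
    (ae_of_all _ fun y => ?_)
  rw [Real.norm_of_nonneg (weight_pos K x y).le]
  exact weight_le hr.le hK y

theorem integrable_inner_mul_weight {K : Body n} {x : E n} (hx : x ∈ interior K.set) (v : E n) :
    Integrable fun y => ⟪v, y⟫ * weight K x y := by
  obtain ⟨r, hr, hK⟩ := exists_closedBall_subset hx
  refine ((integrable_exp_neg_mul_norm (half_pos hr)).const_mul (‖v‖ * (2 / r))).mono'
    (by have := continuous_weight K x; exact (by fun_prop : Continuous _).aestronglyMeasurable)
    (ae_of_all _ fun y => ?_)
  rw [norm_mul, Real.norm_of_nonneg (weight_pos K x y).le]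
  -- The factor `‖y‖` is absorbed by half of the exponential decay, since `t ≤ exp t`.
  have h1 : ‖y‖ ≤ 2 / r * Real.exp (r / 2 * ‖y‖) := by
    have := Real.add_one_le_exp (r / 2 * ‖y‖)
    rw [div_mul_eq_mul_div, le_div_iff₀ hr]
    nlinarith
  have h2 : Real.exp (r / 2 * ‖y‖) * Real.exp (-(r * ‖y‖)) = Real.exp (-(r / 2 * ‖y‖)) := by
    rw [← Real.exp_add]; congr 1; ring
  calc ‖⟪v, y⟫‖ * weight K x y ≤ (‖v‖ * ‖y‖) * Real.exp (-(r * ‖y‖)) :=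
        mul_le_mul (norm_inner_le_norm v y) (weight_le hr.le hK y) (weight_pos K x y).le
          (by positivity)
    _ ≤ (‖v‖ * (2 / r * Real.exp (r / 2 * ‖y‖))) * Real.exp (-(r * ‖y‖)) := by gcongr
    _ = _ := by rw [← h2]; ring

/-- Where the integral of the weight is finite, the point is interior: at a point of the
boundary with outer normal `u`, translating by `u` does not decrease the weight, so that an
integrable weight would be invariant under this translation, and `K` would be flat. -/
theorem mem_interior_of_integrable_weight {K : Body n} {x : E n} (hx : x ∈ K.set)
    (hi : Integrable (weight K x)) : x ∈ interior K.set := by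
  by_contra hx'
  obtain ⟨z, hz⟩ := K.nonempty_interior
  obtain ⟨f, hf⟩ := geometric_hahn_banach_open_point K.convex.interior isOpen_interior hx'
  set u := (InnerProductSpace.toDual ℝ (E n)).symm f with hu
  have hfu : ∀ a, f a = ⟪a, u⟫ := fun a => by
    rw [real_inner_comm, hu, InnerProductSpace.toDual_symm_apply]
  -- `u` supports the interior of `K` at `x`, hence also its closure `K`.
  have hmax : ∀ a ∈ K.set, ⟪a, u⟫ ≤ ⟪x, u⟫ := fun a ha => by
    have : a ∈ closure (interior K.set) := by
      rw [K.convex.closure_interior_eq_closure_of_nonempty_interior K.nonempty_interior]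
      exact subset_closure ha
    refine closure_minimal (fun b hb => ?_) (isClosed_le (by fun_prop) continuous_const :
      IsClosed {a | ⟪a, u⟫ ≤ ⟪x, u⟫}) this
    have := hf b hb
    rw [hfu, hfu] at this
    exact this.le
  have hsupp : supp K u = ⟪x, u⟫ :=
    le_antisymm ((supp_le_iff K).2 hmax) (inner_le_supp K hx u)
  have hle : ∀ y, weight K x y ≤ weight K x (y + u) := fun y => by
    have := supp_add_le K y u
    refine Real.exp_le_exp.2 ?_
    rw [inner_add_right]
    linarith
  have hcont : Continuous fun y => weight K x (y + u) :=
    (continuous_weight K x).comp (continuous_add_const u)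
  have heq : (fun y => weight K x (y + u) - weight K x y) =ᵐ[volume] 0 := by
    rw [← integral_eq_zero_iff_of_nonneg (fun y => sub_nonneg.2 (hle y))
      ((hi.comp_add_right u).sub hi)]
    rw [integral_sub (hi.comp_add_right u) hi, integral_add_right_eq_self, sub_self]
  have h0 := congrFun ((Continuous.ae_eq_iff_eq (μ := volume)
    (by exact hcont.sub (continuous_weight K x)) continuous_zero).1 heq) (-u)
  have hs0 : supp K 0 = 0 := by
    obtain ⟨a, -, h⟩ := exists_inner_eq_supp K (0 : E n)
    simp [← h]
  simp only [Pi.zero_apply, neg_add_cancel, weight, hs0, inner_zero_right,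
    sub_zero, neg_zero, sub_eq_zero, Real.exp_eq_exp, inner_neg_right] at h0
  -- `h_K(-u) = -⟨x, u⟩` contradicts `⟨z, u⟩ < ⟨x, u⟩` for the interior point `z`.
  have h1 := inner_le_supp K (interior_subset hz) (-u)
  have h2 := hf z hz
  rw [hfu, hfu] at h2
  rw [inner_neg_right] at h1
  linarith

/-- The integral `∫ exp (⟨x, y⟩ - h_K(y)) dy`, with values in `[0, ∞]`, which equals
`n! |Kˣ|` for `x ∈ K` and is infinite on the boundary of `K`. -/
def polarFunctional (K : Body n) (x : E n) : ENNReal := ∫⁻ y, ENNReal.ofReal (weight K x y)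

theorem polarFunctional_eq {K : Body n} {x : E n} (hx : x ∈ interior K.set) :
    polarFunctional K x = ENNReal.ofReal (∫ y, weight K x y) :=
  (ofReal_integral_eq_lintegral_ofReal (integrable_weight hx)
    (ae_of_all _ fun y => (weight_pos K x y).le)).symm

theorem lowerSemicontinuous_polarFunctional (K : Body n) :
    LowerSemicontinuous (polarFunctional K) := by
  refine lowerSemicontinuous_iff_le_liminf.2 fun x => ?_
  have hc : ∀ y, Continuous fun x => ENNReal.ofReal (weight K x y) := fun y => by
    unfold weight
    exact ENNReal.continuous_ofReal.comp (by fun_prop)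
  calc polarFunctional K x
      = ∫⁻ y, liminf (fun z => ENNReal.ofReal (weight K z y)) (𝓝 x) :=
        lintegral_congr fun y => ((hc y).tendsto x).liminf_eq.symm
    _ ≤ _ := lintegral_liminf_le fun z =>
        ENNReal.measurable_ofReal.comp (continuous_weight K z).measurable

/-- The functional is lower semicontinuous, so it attains its minimum over the compact set `K`; there
it is finite, which places the minimum in the interior. -/
theorem exists_forall_integral_weight_le (K : Body n) : ∃ x ∈ interior K.set,
    ∀ z ∈ interior K.set, ∫ y, weight K x y ≤ ∫ y, weight K z y := by
  obtain ⟨x, hx, hmin⟩ := (lowerSemicontinuous_polarFunctional K).lowerSemicontinuousOn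
    K.set |>.exists_isMinOn K.nonempty K.isCompact
  have hle : ∀ z ∈ interior K.set, polarFunctional K x ≤ polarFunctional K z :=
    fun z hz => hmin (interior_subset hz)
  have hxi : x ∈ interior K.set := by
    obtain ⟨z, hz⟩ := K.nonempty_interior
    refine mem_interior_of_integrable_weight hx
      ⟨(continuous_weight K x).aestronglyMeasurable, ?_⟩
    rw [hasFiniteIntegral_iff_ofReal (ae_of_all _ fun y => (weight_pos K x y).le)]
    refine (hle z hz).trans_lt ?_
    rw [polarFunctional_eq hz]
    exact ENNReal.ofReal_lt_top
  refine ⟨x, hxi, fun z hz => ?_⟩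
  have h := hle z hz
  rwa [polarFunctional_eq hxi, polarFunctional_eq hz, ENNReal.ofReal_le_ofReal_iff
    (integral_nonneg fun y => (weight_pos K z y).le)] at h

theorem inner_eq_zero_ae_iff {v : E n} : (fun y => ⟪v, y⟫) =ᵐ[volume] 0 ↔ v = 0 := by
  rw [Continuous.ae_eq_iff_eq _ (by fun_prop) continuous_zero]
  refine ⟨fun h => inner_self_eq_zero.1 (congrFun h v), ?_⟩
  rintro rfl
  ext y
  simp

/-- A critical point of the convex function `x ↦ ∫ exp (⟨x, y⟩ - h_K(y)) dy` is its unique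
minimum: integrate the tangent line inequality `exp t ≥ 1 + t`. -/
theorem integral_weight_lt_of_critical {K : Body n} {x z : E n} (hx : x ∈ interior K.set)
    (hcrit : ∀ v, ∫ y, ⟪v, y⟫ * weight K x y = 0) (hz : z ∈ interior K.set) (hne : z ≠ x) :
    ∫ y, weight K x y < ∫ y, weight K z y := by
  have hi1 := integrable_weight hx
  have hi2 := integrable_inner_mul_weight hx (z - x)
  have hi3 := integrable_weight hz
  have hw : ∀ y, weight K z y = weight K x y * Real.exp ⟪z - x, y⟫ := fun y => by
    rw [weight, weight, ← Real.exp_add, inner_sub_left]; congr 1; ring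
  have key : ∫ y, weight K x y =
      ∫ y, (weight K x y + ⟪z - x, y⟫ * weight K x y) := by
    rw [integral_add hi1 hi2, hcrit, add_zero]
  rw [key]
  have hnn : ∀ y, 0 ≤ weight K z y - (weight K x y + ⟪z - x, y⟫ * weight K x y) := fun y => by
    have := mul_le_mul_of_nonneg_left (Real.add_one_le_exp ⟪z - x, y⟫) (weight_pos K x y).le
    rw [hw]; linarith
  refine lt_of_le_of_ne (integral_mono (hi1.add hi2) hi3 fun y => sub_nonneg.1 (hnn y)) fun h => ?_
  have h0 : ∫ y, (weight K z y - (weight K x y + ⟪z - x, y⟫ * weight K x y)) = 0 := by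
    exact (integral_sub hi3 (hi1.add hi2)).trans (sub_eq_zero.2 h.symm)
  rw [integral_eq_zero_iff_of_nonneg hnn (hi3.sub (hi1.add hi2))] at h0
  refine hne (sub_eq_zero.1 (inner_eq_zero_ae_iff.1 ?_))
  filter_upwards [h0] with y hy
  by_contra hyne
  have := mul_lt_mul_of_pos_left (Real.add_one_lt_exp hyne) (weight_pos K x y)
  simp only [Pi.zero_apply, hw] at hy
  linarith

/-- A minimum of `x ↦ ∫ exp (⟨x, y⟩ - h_K(y)) dy` in the interior is a critical point: along a line
`x + t v`, this integral is the moment generating function of `y ↦ ⟨v, y⟩` under the measure with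
density `weight K x`, whose derivative at `0` is the mean of `⟨v, y⟩`. -/
theorem critical_of_forall_le {K : Body n} {x : E n} (hx : x ∈ interior K.set)
    (hmin : ∀ z ∈ interior K.set, ∫ y, weight K x y ≤ ∫ y, weight K z y) (v : E n) :
    ∫ y, ⟪v, y⟫ * weight K x y = 0 := by
  set μ : Measure (E n) := volume.withDensity fun y => ENNReal.ofReal (weight K x y) with hμ
  have hmeas : Measurable fun y => (weight K x y).toNNReal :=
    measurable_real_toNNReal.comp (continuous_weight K x).measurable
  have hint : ∀ g : E n → ℝ, ∫ y, g y ∂μ = ∫ y, g y * weight K x y := fun g => by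
    rw [hμ]
    change ∫ y, g y ∂(volume.withDensity fun y => ((weight K x y).toNNReal : ENNReal)) = _
    rw [integral_withDensity_eq_integral_smul hmeas]
    refine integral_congr_ae (ae_of_all _ fun y => ?_)
    simp [NNReal.smul_def, (weight_pos K x y).le, mul_comm]
  have hinteg : ∀ g : E n → ℝ, Integrable (fun y => g y * weight K x y) → Integrable g μ :=
    fun g hg => by
    rw [hμ]
    change Integrable g (volume.withDensity fun y => ((weight K x y).toNNReal : ENNReal))
    rw [integrable_withDensity_iff_integrable_smul hmeas]
    refine hg.congr (ae_of_all _ fun y => ?_)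
    simp [NNReal.smul_def, (weight_pos K x y).le, mul_comm]
  have hw : ∀ t y, Real.exp (t * ⟪v, y⟫) * weight K x y = weight K (x + t • v) y := fun t y => by
    rw [weight, weight, ← Real.exp_add, inner_add_left, real_inner_smul_left]; congr 1; ring
  have hnear : ∀ᶠ t in 𝓝 (0 : ℝ), x + t • v ∈ interior K.set := by
    have hc : ContinuousAt (fun t : ℝ => x + t • v) 0 := by fun_prop
    exact hc.eventually_mem (isOpen_interior.mem_nhds (by simpa using hx))
  have h0 : (0 : ℝ) ∈ interior (ProbabilityTheory.integrableExpSet (fun y => ⟪v, y⟫) μ) := by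
    rw [mem_interior_iff_mem_nhds]
    filter_upwards [hnear] with t ht
    refine hinteg _ ?_
    simp only [hw]
    exact integrable_weight ht
  have hmgf : ∀ t, ProbabilityTheory.mgf (fun y => ⟪v, y⟫) μ t =
      ∫ y, weight K (x + t • v) y := fun t => by
    simp only [ProbabilityTheory.mgf, hint, hw]
  have hloc : IsLocalMin (ProbabilityTheory.mgf (fun y => ⟪v, y⟫) μ) 0 := by
    filter_upwards [hnear] with t ht
    rw [hmgf, hmgf, zero_smul, add_zero]
    exact hmin _ ht
  rw [← hint, ← ProbabilityTheory.deriv_mgf_zero h0]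
  exact hloc.deriv_eq_zero

/-! ### Moments of the polar body -/

/-- The polar of `K - x`, as a sublevel set of the support function of `K - x`. -/
theorem mem_polarAt_add_iff (K : Body n) (x y : E n) :
    y + x ∈ polarAt K.set x ↔ supp K y - ⟪x, y⟫ ≤ 1 := by
  rw [mem_polarAt, sub_le_iff_le_add, supp_le_iff]
  refine forall₂_congr fun a _ => ?_
  rw [add_sub_cancel_right, inner_sub_left, sub_le_iff_le_add]

theorem preimage_add_polarAt (K : Body n) (x : E n) :
    (fun y => y + x) ⁻¹' polarAt K.set x = {y | supp K y - ⟪x, y⟫ ≤ 1} := by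
  ext y
  exact mem_polarAt_add_iff K x y

theorem supp_sub_inner_nonneg {K : Body n} {x : E n} (hx : x ∈ K.set) (y : E n) :
    0 ≤ supp K y - ⟪x, y⟫ := sub_nonneg.2 (inner_le_supp K hx y)

theorem lintegral_mul_weight {K : Body n} {x : E n} (hx : x ∈ K.set) {k : ℕ}
    {G : E n → ENNReal} (hG : Measurable G)
    (hGs : ∀ t : ℝ, 0 < t → ∀ y, G (t • y) = ENNReal.ofReal (t ^ k) * G y) :
    ∫⁻ y, G y * ENNReal.ofReal (weight K x y) =
      ENNReal.ofReal (Nat.factorial (n + k)) * ∫⁻ y in {y | supp K y - ⟪x, y⟫ ≤ 1}, G y := by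
  refine lintegral_mul_exp_neg ?_ (supp_sub_inner_nonneg hx) (fun t ht y => ?_) hG hGs
  · have := continuous_supp K
    fun_prop
  · rw [supp_smul K ht, inner_smul_right]; ring

theorem polarFunctional_eq_volume {K : Body n} {x : E n} (hx : x ∈ K.set) :
    polarFunctional K x = ENNReal.ofReal (Nat.factorial n) * volume (polarAt K.set x) := by
  have h := lintegral_mul_weight (k := 0) hx (G := fun _ => 1) (by fun_prop) (by simp)
  simp only [one_mul, lintegral_const, Measure.restrict_apply_univ, add_zero] at h
  rw [polarFunctional, h, ← preimage_add_polarAt, measure_preimage_add_right]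

/-- The first moments of the weight are `(n + 1)!` times those of `(K - x)°`. The layer cake formula
is applied to the positive and the negative part of `y ↦ ⟨v, y⟩`. -/
theorem integral_inner_mul_weight {K : Body n} {x : E n} (hx : x ∈ interior K.set) (v : E n) :
    ∫ y, ⟪v, y⟫ * weight K x y = Nat.factorial (n + 1) *
      ∫ y in {y | supp K y - ⟪x, y⟫ ≤ 1}, ⟪v, y⟫ := by
  have key : ∀ u : E n, ∫⁻ y, ENNReal.ofReal (⟪u, y⟫ * weight K x y) =
      ENNReal.ofReal (Nat.factorial (n + 1)) *
        ∫⁻ y in {y | supp K y - ⟪x, y⟫ ≤ 1}, ENNReal.ofReal ⟪u, y⟫ := fun u => by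
    rw [← lintegral_mul_weight (k := 1) (interior_subset hx)
      (G := fun y => ENNReal.ofReal ⟪u, y⟫) (by fun_prop)
      (fun t ht y => by rw [inner_smul_right, ENNReal.ofReal_mul ht.le, pow_one])]
    refine lintegral_congr fun y => ?_
    rw [ENNReal.ofReal_mul' (weight_pos K x y).le]
  have hint : IntegrableOn (fun y => ⟪v, y⟫) {y | supp K y - ⟪x, y⟫ ≤ 1} := by
    refine ContinuousOn.integrableOn_compact ?_ (by fun_prop)
    rw [← preimage_add_polarAt]
    exact (Homeomorph.addRight x).isCompact_preimage.2 (K.polar x hx).isCompact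
  rw [integral_eq_lintegral_pos_part_sub_lintegral_neg_part (integrable_inner_mul_weight hx v),
    integral_eq_lintegral_pos_part_sub_lintegral_neg_part hint, key v]
  have h2 := key (-v)
  simp only [inner_neg_left, neg_mul] at h2
  rw [h2, ENNReal.toReal_mul, ENNReal.toReal_mul, ENNReal.toReal_ofReal (by positivity), mul_sub]

theorem volume_set_ne_zero (K : Body n) : volume K.set ≠ 0 :=
  (Measure.measure_pos_of_nonempty_interior _ K.nonempty_interior).ne'

theorem volume_set_ne_top (K : Body n) : volume K.set ≠ ⊤ := K.isCompact.measure_ne_top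

theorem volume_real_ne_zero (K : Body n) : volume.real K.set ≠ 0 :=
  (ENNReal.toReal_pos (volume_set_ne_zero K) (volume_set_ne_top K)).ne'

theorem integrableOn_set (K : Body n) {F : Type*} [NormedAddCommGroup F] {f : E n → F}
    (hf : Continuous f) : IntegrableOn f K.set :=
  hf.continuousOn.integrableOn_compact K.isCompact

/-- The centroid is the point with respect to which all first moments of `K` vanish. -/
theorem centroid_eq_iff (K : Body n) (x : E n) :
    centroid K = x ↔ ∀ v, ∫ y in K.set, ⟪v, y - x⟫ = 0 := by
  have h : ∀ v, ∫ y in K.set, ⟪v, y - x⟫ = ⟪v, (∫ y in K.set, y) - volume.real K.set • x⟫ :=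
    fun v => by
    rw [integral_inner (integrableOn_set K (by fun_prop)),
      integral_sub (integrableOn_set K (f := fun y => y) continuous_id)
        (integrableOn_set K continuous_const),
      setIntegral_const]
  simp only [h]
  rw [centroid, inv_smul_eq_iff₀ (volume_real_ne_zero K), ← sub_eq_zero]
  exact ⟨fun e v => by rw [e, inner_zero_right], fun e => inner_self_eq_zero.1 (e _)⟩

theorem centroid_polar_eq_iff {K : Body n} {x : E n} (hx : x ∈ interior K.set) :
    centroid (K.polar x hx) = x ↔ ∀ v, ∫ y, ⟪v, y⟫ * weight K x y = 0 := by
  rw [centroid_eq_iff]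
  refine forall_congr' fun v => ?_
  have h := (measurePreserving_add_right (volume : Measure (E n)) x).setIntegral_preimage_emb
    (measurableEmbedding_addRight x) (fun y => ⟪v, y - x⟫) (polarAt K.set x)
  rw [preimage_add_polarAt] at h
  simp only [add_sub_cancel_right] at h
  change ∫ y in polarAt K.set x, _ = 0 ↔ _
  rw [← h, integral_inner_mul_weight hx, mul_eq_zero,
    or_iff_right (Nat.cast_ne_zero.2 (Nat.factorial_ne_zero _))]

theorem volume_polarAt_le_iff {K : Body n} {x z : E n} (hx : x ∈ interior K.set)
    (hz : z ∈ interior K.set) : volume (polarAt K.set x) ≤ volume (polarAt K.set z) ↔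
      ∫ y, weight K x y ≤ ∫ y, weight K z y := by
  have hn : ENNReal.ofReal (Nat.factorial n) ≠ 0 := by
    simp [Nat.factorial_ne_zero]
  rw [← ENNReal.ofReal_le_ofReal_iff (integral_nonneg fun y => (weight_pos K z y).le),
    ← polarFunctional_eq hx, ← polarFunctional_eq hz,
    polarFunctional_eq_volume (interior_subset hx), polarFunctional_eq_volume (interior_subset hz),
    ENNReal.mul_le_mul_iff_right hn ENNReal.ofReal_ne_top]

/-! ### The Santaló point -/

theorem isSantaloPoint_iff_integral {K : Body n} {x : E n} : IsSantaloPoint K x ↔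
    x ∈ interior K.set ∧ ∀ z ∈ interior K.set, ∫ y, weight K x y ≤ ∫ y, weight K z y :=
  and_congr_right fun hx => forall₂_congr fun _ hz => volume_polarAt_le_iff hx hz

/-- The Santaló point is characterized by the vanishing of the first moment of the polar body:
`x = s(K)` if and only if `x` is the centroid of `Kˣ`. -/
theorem isSantaloPoint_iff_centroid {K : Body n} {x : E n} (hx : x ∈ interior K.set) :
    IsSantaloPoint K x ↔ centroid (K.polar x hx) = x := by
  rw [centroid_polar_eq_iff, isSantaloPoint_iff_integral]
  refine ⟨fun h => critical_of_forall_le hx h.2, fun h => ⟨hx, fun z hz => ?_⟩⟩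
  rcases eq_or_ne z x with rfl | hne
  · exact le_rfl
  · exact (integral_weight_lt_of_critical hx h hz hne).le

theorem IsSantaloPoint.integral_lt {K : Body n} {x z : E n} (h : IsSantaloPoint K x)
    (hz : z ∈ interior K.set) (hne : z ≠ x) : ∫ y, weight K x y < ∫ y, weight K z y :=
  integral_weight_lt_of_critical h.1
    ((centroid_polar_eq_iff h.1).1 ((isSantaloPoint_iff_centroid h.1).1 h)) hz hne

theorem IsSantaloPoint.eq {K : Body n} {x z : E n} (hx : IsSantaloPoint K x)
    (hz : IsSantaloPoint K z) : x = z := by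
  by_contra hne
  exact ((hx.integral_lt hz.1 (Ne.symm hne)).trans (hz.integral_lt hx.1 hne)).false

theorem isSantaloPoint_santaloPoint (K : Body n) : IsSantaloPoint K (santaloPoint K) := by
  obtain ⟨x, hx⟩ := exists_forall_integral_weight_le K
  have h : ∃ x, IsSantaloPoint K x := ⟨x, isSantaloPoint_iff_integral.2 hx⟩
  rw [santaloPoint, dif_pos h]
  exact h.choose_spec

theorem IsSantaloPoint.eq_santaloPoint {K : Body n} {x : E n} (h : IsSantaloPoint K x) :
    x = santaloPoint K := h.eq (isSantaloPoint_santaloPoint K)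

/-! ### Bipolar theorem -/

theorem polarAt_polarAt {K : Body n} {x : E n} (hx : x ∈ interior K.set) :
    polarAt (polarAt K.set x) x = K.set := by
  refine Subset.antisymm (fun z hz => mem_of_forall_inner_le_supp K fun y => ?_) fun z hz => ?_
  · rw [mem_polarAt] at hz
    -- Scale `y` by any `c > h_{K - x}(y)` to a point of the polar of `K - x`.
    refine le_of_forall_gt_imp_ge_of_dense fun d hd => ?_
    have hc : 0 < d - ⟪x, y⟫ := by linarith [inner_le_supp K (interior_subset hx) y]
    have hy : (d - ⟪x, y⟫)⁻¹ • y + x ∈ polarAt K.set x := by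
      rw [mem_polarAt_add_iff, supp_smul K (inv_pos.2 hc), inner_smul_right, ← mul_sub,
        inv_mul_le_iff₀ hc]
      linarith
    have h := hz _ hy
    rw [add_sub_cancel_right, real_inner_smul_left, inv_mul_le_iff₀ hc, inner_sub_right,
      real_inner_comm z y, real_inner_comm x y] at h
    linarith
  · rw [mem_polarAt]
    intro a ha
    rw [real_inner_comm]
    exact mem_polarAt.1 ha z hz

theorem mem_interior_polar (K : Body n) {x : E n} (hx : x ∈ interior K.set) :
    x ∈ interior (K.polar x hx).set := mem_interior_polarAt K.1.isBounded

theorem Body.ext {K L : Body n} (h : K.set = L.set) : K = L := Subtype.ext (SetLike.coe_injective h)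

theorem polar_polar (K : Body n) {x : E n} (hx : x ∈ interior K.set) :
    (K.polar x hx).polar x (mem_interior_polar K hx) = K :=
  Body.ext (polarAt_polarAt hx)

/-! ### The centroid as a proper affine invariant point -/

theorem closedBall_subset_of_dist_lt {K L : Body n} {x : E n} {r δ : ℝ}
    (hK : Metric.closedBall x r ⊆ K.set) (hd : dist K L < δ) (hδ : δ ≤ r) :
    Metric.closedBall x (r - δ) ⊆ L.set := by
  intro a ha
  refine mem_of_forall_inner_le_supp L fun y => ?_
  have hr : 0 ≤ r := dist_nonneg.trans (hd.le.trans hδ)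
  have h1 := inner_add_le_supp hr hK y
  have h2 := supp_le_supp_add hd y
  have h3 : ⟪a - x, y⟫ ≤ (r - δ) * ‖y‖ := (real_inner_le_norm _ _).trans
    (mul_le_mul_of_nonneg_right (by rw [← dist_eq_norm]; exact ha) (norm_nonneg _))
  rw [inner_sub_left] at h3
  linarith

theorem eventually_mem_interior {K : Body n} {x : E n} (hx : x ∈ interior K.set) :
    ∀ᶠ L in 𝓝 K, x ∈ interior L.set := by
  obtain ⟨r, hr, hK⟩ := exists_closedBall_subset hx
  filter_upwards [Metric.ball_mem_nhds K (half_pos hr)] with L hL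
  have hd : dist K L < r / 2 := by rw [dist_comm]; exact hL
  exact interior_mono (closedBall_subset_of_dist_lt hK hd (by linarith))
    (mem_interior_iff_mem_nhds.2 (Metric.closedBall_mem_nhds x (by linarith)))

theorem eventually_notMem {K : Body n} {x : E n} (hx : x ∉ K.set) :
    ∀ᶠ L in 𝓝 K, x ∉ L.set := by
  obtain ⟨y, hy⟩ : ∃ y, supp K y < ⟪x, y⟫ := by
    by_contra! h
    exact hx (mem_of_forall_inner_le_supp K h)
  filter_upwards [(continuous_supp_left y).continuousAt.eventually_lt_const hy] with L hL hxL
  exact (inner_le_supp L hxL y).not_gt hL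

/-- Integrals of a fixed continuous function over a convex body depend continuously on the body:
off the boundary of `K`, which is a null set, the indicators converge pointwise. -/
theorem continuous_setIntegral {F : Type*} [NormedAddCommGroup F] [NormedSpace ℝ F] {f : E n → F}
    (hf : Continuous f) : Continuous fun K : Body n => ∫ y in K.set, f y := by
  refine continuous_iff_continuousAt.2 fun K => ?_
  simp only [fun L : Body n => (integral_indicator (μ := volume) (f := f)
    L.isClosed.measurableSet).symm]
  obtain ⟨R, hR⟩ := K.isCompact.isBounded.exists_norm_le
  refine continuousAt_of_dominated (bound := (Metric.closedBall 0 (R + 1)).indicator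
    fun y => ‖f y‖) ?_ ?_ ?_ ?_
  · exact Eventually.of_forall fun L =>
      hf.aestronglyMeasurable.indicator L.isClosed.measurableSet
  · filter_upwards [Metric.ball_mem_nhds K one_pos] with L hL
    refine ae_of_all _ fun y => ?_
    rw [norm_indicator_eq_indicator_norm]
    refine indicator_le_indicator_of_subset (fun a ha => ?_) (fun _ => norm_nonneg _) y
    obtain ⟨b, hb, hab⟩ := exists_mem_dist_lt hL ha
    rw [mem_closedBall_zero_iff]
    have h1 : ‖a - b‖ < 1 := by rwa [← dist_eq_norm]
    have h2 := norm_add_le (a - b) b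
    rw [sub_add_cancel] at h2
    linarith [hR b hb]
  · exact (hf.norm.continuousOn.integrableOn_compact
      (isCompact_closedBall _ _)).integrable_indicator Metric.isClosed_closedBall.measurableSet
  · have h0 : ∀ᵐ y ∂(volume : Measure (E n)), y ∉ frontier K.set :=
      measure_eq_zero_iff_ae_notMem.1 (K.convex.addHaar_frontier volume)
    filter_upwards [h0] with y hy
    by_cases hyK : y ∈ K.set
    · have hyi : y ∈ interior K.set := by
        by_contra h
        exact hy ⟨subset_closure hyK, h⟩
      refine (continuousAt_const (y := f y)).congr ?_
      filter_upwards [eventually_mem_interior hyi] with L hL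
      exact (indicator_of_mem (interior_subset hL) f).symm
    · refine (continuousAt_const (y := (0 : F))).congr ?_
      filter_upwards [eventually_notMem hyK] with L hL
      exact (indicator_of_notMem hL f).symm

theorem continuous_centroid : Continuous (centroid : Body n → E n) := by
  have h1 : Continuous fun K : Body n => volume.real K.set := by
    simpa using continuous_setIntegral (n := n) (f := fun _ => (1 : ℝ)) continuous_const
  exact (h1.inv₀ volume_real_ne_zero).smul (continuous_setIntegral continuous_id)

/-- The mean of `K` is a proper convex combination of a point of `closure K` and the mean of a
small ball inside `K`, and the latter is an interior point. -/
theorem centroid_mem_interior (K : Body n) : centroid K ∈ interior K.set := by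
  obtain ⟨x, hx⟩ := K.nonempty_interior
  obtain ⟨r, hr, hK⟩ := Metric.nhds_basis_closedBall.mem_iff.1
    (isOpen_interior.mem_nhds hx)
  have hKf : IsFiniteMeasure (volume.restrict K.set) := ⟨by
    rw [Measure.restrict_apply_univ]; exact (volume_set_ne_top K).lt_top⟩
  have hsub : Metric.closedBall x r ⊆ K.set := hK.trans interior_subset
  have hpos : volume (Metric.closedBall x r) ≠ 0 := (Metric.measure_closedBall_pos _ _ hr).ne'
  have hr' : (volume.restrict K.set).restrict (Metric.closedBall x r) =
      volume.restrict (Metric.closedBall x r) := by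
    rw [Measure.restrict_restrict Metric.isClosed_closedBall.measurableSet,
      inter_eq_left.2 hsub]
  have h := K.convex.average_mem_interior_of_set (μ := volume.restrict K.set)
    (t := Metric.closedBall x r) (f := fun y => y)
    (by rwa [Measure.restrict_apply Metric.isClosed_closedBall.measurableSet,
      inter_eq_left.2 hsub])
    (ae_restrict_mem K.isClosed.measurableSet) (integrableOn_set K continuous_id)
    (by
      rw [hr']
      exact hK ((convex_closedBall x r).set_average_mem Metric.isClosed_closedBall hpos
        measure_closedBall_lt_top.ne (ae_restrict_mem Metric.isClosed_closedBall.measurableSet)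
        ((continuous_id (X := E n)).continuousOn.integrableOn_compact (isCompact_closedBall x r))))
  rwa [setAverage_eq] at h

theorem centroid_image (T : E n ≃ᵃ[ℝ] E n) (K : Body n) :
    centroid (K.image T) = T (centroid K) := by
  rw [centroid_eq_iff]
  intro v
  set A : E n →L[ℝ] E n := T.linear.toLinearMap.toContinuousLinearMap with hA
  have hsub : ∀ a b, T a - T b = A (a - b) := fun a b =>
    ((T : E n →ᵃ[ℝ] E n).linearMap_vsub a b).symm
  have hder : ∀ x ∈ K.set, HasFDerivWithinAt T A K.set x := fun x _ => by
    have : (T : E n → E n) = fun a => A a + (T x - A x) := by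
      ext1 a
      rw [add_comm, sub_add, ← map_sub, ← neg_sub a x, map_neg, ← hsub]
      abel
    rw [this]
    exact (A.hasFDerivAt.add_const _).hasFDerivWithinAt
  change ∫ y in T '' K.set, _ = 0
  rw [integral_image_eq_integral_abs_det_fderiv_smul volume K.isClosed.measurableSet hder
    T.injective.injOn, integral_smul]
  have h := (centroid_eq_iff K (centroid K)).1 rfl (A.adjoint v)
  simp only [ContinuousLinearMap.adjoint_inner_left] at h
  simp only [hsub, h, smul_zero]

/-! ### The Santaló point as a proper affine invariant point -/

/-- Under an affine map with linear part `A`, the support function of `K - x` is composed with the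
adjoint of `A`. -/
theorem supp_image_sub_inner (T : E n ≃ᵃ[ℝ] E n) (K : Body n) (x y : E n) :
    supp (K.image T) y - ⟪T x, y⟫ =
      supp K (T.linear.toLinearMap.adjoint y) - ⟪x, T.linear.toLinearMap.adjoint y⟫ := by
  have hsub : ∀ a, ⟪T a, y⟫ - ⟪T x, y⟫ =
      ⟪a, T.linear.toLinearMap.adjoint y⟫ - ⟪x, T.linear.toLinearMap.adjoint y⟫ := fun a => by
    rw [← inner_sub_left, ← inner_sub_left, LinearMap.adjoint_inner_right]
    exact congrArg (⟪·, y⟫) ((T : E n →ᵃ[ℝ] E n).linearMap_vsub a x).symm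
  apply le_antisymm
  · rw [sub_le_iff_le_add, supp_le_iff]
    rintro _ ⟨a, ha, rfl⟩
    linarith [hsub a, inner_le_supp K ha (T.linear.toLinearMap.adjoint y)]
  · rw [sub_le_iff_le_add, supp_le_iff]
    intro a ha
    linarith [hsub a, inner_le_supp (K.image T) (mem_image_of_mem T ha) y]

theorem interior_image (T : E n ≃ᵃ[ℝ] E n) (K : Body n) :
    interior (K.image T).set = T '' interior K.set :=
  (T.toContinuousAffineEquiv.toHomeomorph.image_interior K.set).symm

theorem IsSantaloPoint.image {K : Body n} {x : E n} (h : IsSantaloPoint K x)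
    (T : E n ≃ᵃ[ℝ] E n) : IsSantaloPoint (K.image T) (T x) := by
  have hdet : LinearMap.det T.linear.toLinearMap.adjoint ≠ 0 := by
    have h1 : T.linear.symm.toLinearMap.adjoint ∘ₗ T.linear.toLinearMap.adjoint =
        LinearMap.id := by
      rw [← LinearMap.adjoint_comp, LinearEquiv.comp_coe, LinearEquiv.symm_trans_self,
        LinearEquiv.refl_toLinearMap, LinearMap.adjoint_id]
    intro h0
    simpa [LinearMap.det_comp, h0] using congrArg LinearMap.det h1
  have hint : ∀ z, ∫ y, weight (K.image T) (T z) y =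
      |(LinearMap.det T.linear.toLinearMap.adjoint)⁻¹| * ∫ y, weight K z y := fun z => by
    have hm := Measure.map_linearMap_addHaar_eq_smul_addHaar (volume : Measure (E n)) hdet
    have hc : Continuous T.linear.toLinearMap.adjoint := LinearMap.continuous_of_finiteDimensional _
    have h1 := integral_map (μ := volume) hc.aemeasurable
      (continuous_weight K z).aestronglyMeasurable
    rw [hm, integral_smul_measure, ENNReal.toReal_ofReal (abs_nonneg _), smul_eq_mul] at h1
    rw [h1]
    simp only [weight, supp_image_sub_inner]
  rw [isSantaloPoint_iff_integral] at h ⊢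
  rw [interior_image]
  refine ⟨mem_image_of_mem T h.1, ?_⟩
  rintro _ ⟨z, hz, rfl⟩
  rw [hint, hint]
  exact mul_le_mul_of_nonneg_left (h.2 z hz) (abs_nonneg _)

/-- Joint continuity in the body and the point, by dominated convergence: if `B(x, r) ⊆ K`, then the
weight decays like `exp (-(r / 2) ‖y‖)` uniformly near `(K, x)`. -/
theorem continuousAt_integral_weight {K : Body n} {x : E n} (hx : x ∈ interior K.set) :
    ContinuousAt (fun p : Body n × E n => ∫ y, weight p.1 p.2 y) (K, x) := by
  obtain ⟨r, hr, hK⟩ := exists_closedBall_subset hx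
  refine continuousAt_of_dominated (bound := fun y => Real.exp (-(r / 2 * ‖y‖))) ?_ ?_
    (integrable_exp_neg_mul_norm (half_pos hr)) ?_
  · exact Eventually.of_forall fun p => (continuous_weight p.1 p.2).aestronglyMeasurable
  · filter_upwards [Metric.ball_mem_nhds (K, x) (show 0 < r / 4 by linarith)] with p hp
    rw [Metric.mem_ball, Prod.dist_eq, max_lt_iff] at hp
    refine ae_of_all _ fun y => ?_
    rw [Real.norm_of_nonneg (weight_pos _ _ y).le]
    have h1 := inner_add_le_supp hr.le hK y
    have h2 := supp_le_supp_add (K := K) (L := p.1) (by rw [dist_comm]; exact hp.1) y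
    have h3 : ⟪p.2 - x, y⟫ ≤ r / 4 * ‖y‖ := (real_inner_le_norm _ _).trans
      (mul_le_mul_of_nonneg_right (by rw [← dist_eq_norm]; exact hp.2.le) (norm_nonneg _))
    rw [inner_sub_left] at h3
    exact Real.exp_le_exp.2 (by linarith)
  · refine ae_of_all _ fun y => Continuous.continuousAt ?_
    have := (continuous_supp_left (n := n) y).comp (continuous_fst (Y := E n))
    unfold weight
    exact Real.continuous_exp.comp (this.sub (by fun_prop)).neg

theorem convexOn_integral_weight (K : Body n) :
    ConvexOn ℝ (interior K.set) fun x => ∫ y, weight K x y := by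
  refine ⟨K.convex.interior, fun x hx z hz a b ha hb hab => ?_⟩
  simp only [smul_eq_mul]
  rw [← integral_const_mul, ← integral_const_mul, ← integral_add
    ((integrable_weight hx).const_mul a) ((integrable_weight hz).const_mul b)]
  refine integral_mono (integrable_weight (K.convex.interior hx hz ha hb hab))
    (((integrable_weight hx).const_mul a).add ((integrable_weight hz).const_mul b)) fun y => ?_
  have h := convexOn_exp.2 (mem_univ (-(supp K y - ⟪x, y⟫))) (mem_univ (-(supp K y - ⟪z, y⟫)))
    ha hb hab
  simp only [smul_eq_mul] at h
  simp only [weight, inner_add_left, real_inner_smul_left]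
  refine le_of_eq_of_le (congrArg Real.exp ?_) h
  linear_combination supp K y * hab

/-- On a small sphere around `s(K)` the functional exceeds its value at `s(K)`; this persists for
bodies near `K`, and by convexity it confines their Santaló points to the small ball. -/
theorem continuous_santaloPoint : Continuous (santaloPoint : Body n → E n) := by
  refine continuous_iff_continuousAt.2 fun K => Metric.tendsto_nhds.2 fun ε hε => ?_
  set s := santaloPoint K with hs
  have hS : IsSantaloPoint K s := isSantaloPoint_santaloPoint K
  obtain ⟨r, hr, hr'⟩ := Metric.nhds_basis_closedBall.mem_iff.1
    (isOpen_interior.mem_nhds hS.1)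
  set ρ := min r (ε / 2) with hρ
  have hρ0 : 0 < ρ := lt_min hr (half_pos hε)
  have hev : ∀ᶠ L in 𝓝 K, ∀ z ∈ Metric.sphere s ρ,
      ∫ y, weight L s y < ∫ y, weight L z y := by
    refine (isCompact_sphere s ρ).eventually_forall_of_forall_eventually fun z hz => ?_
    have hzi : z ∈ interior K.set :=
      hr' (Metric.closedBall_subset_closedBall (min_le_left _ _)
        (Metric.sphere_subset_closedBall hz))
    have h1 : ContinuousAt (fun p : Body n × E n => ∫ y, weight p.1 s y) (K, z) :=
      ContinuousAt.comp (f := fun p : Body n × E n => (p.1, s))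
        (continuousAt_integral_weight hS.1) (by fun_prop)
    exact h1.eventually_lt (continuousAt_integral_weight hzi)
      (hS.integral_lt hzi (Metric.ne_of_mem_sphere hz hρ0.ne'))
  filter_upwards [hev, eventually_mem_interior hS.1] with L hL hsL
  have hT := isSantaloPoint_santaloPoint L
  by_contra! hfar
  have hD : ρ < dist (santaloPoint L) s := by
    have := min_le_right r (ε / 2)
    linarith
  have hD0 : 0 < dist (santaloPoint L) s := hρ0.trans hD
  set t := ρ / dist (santaloPoint L) s with ht
  have ht0 : 0 < t := div_pos hρ0 hD0
  have ht1 : t < 1 := (div_lt_one hD0).2 hD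
  -- The segment from `s` to the Santaló point of `L` crosses the sphere at parameter `t`.
  have hz : (1 - t) • s + t • santaloPoint L ∈ Metric.sphere s ρ := by
    have : (1 - t) • s + t • santaloPoint L - s = t • (santaloPoint L - s) := by module
    rw [Metric.mem_sphere, dist_eq_norm, this, norm_smul, Real.norm_of_nonneg ht0.le,
      ← dist_eq_norm, ht, div_mul_cancel₀ _ hD0.ne']
  have h1 := hL _ hz
  have h2 := (convexOn_integral_weight L).2 hsL hT.1 (sub_nonneg.2 ht1.le) ht0.le (by ring)
  have h3 := (isSantaloPoint_iff_integral.1 hT).2 s hsL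
  simp only [smul_eq_mul] at h2
  nlinarith

theorem isProper_santaloPoint : IsProperAffineInvariantPoint (santaloPoint : Body n → E n) where
  continuous := continuous_santaloPoint
  map_image T K := ((isSantaloPoint_santaloPoint K).image T).eq_santaloPoint.symm
  mem_interior K := (isSantaloPoint_santaloPoint K).1

theorem isProper_centroid : IsProperAffineInvariantPoint (centroid : Body n → E n) where
  continuous := continuous_centroid
  map_image := centroid_image
  mem_interior := centroid_mem_interior

/-! ### Duality -/

theorem santaloPoint_eq_iff_centroid_polar {K : Body n} {x : E n} (hx : x ∈ interior K.set) :
    santaloPoint K = x ↔ centroid (K.polar x hx) = x := by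
  rw [← isSantaloPoint_iff_centroid hx]
  exact ⟨fun h => h ▸ isSantaloPoint_santaloPoint K, fun h => h.eq_santaloPoint.symm⟩

theorem centroid_eq_iff_santaloPoint_polar {K : Body n} {x : E n} (hx : x ∈ interior K.set) :
    centroid K = x ↔ santaloPoint (K.polar x hx) = x := by
  rw [santaloPoint_eq_iff_centroid_polar (mem_interior_polar K hx), polar_polar]

/-- If polarity exchanges `p` and `q`, then `q` is the only dual of `p`: every body `K` is the polar
`L^{p(L)}` of `L = K^{q(K)}`, and `p(L) = q(K)`, so any dual of `p` takes the value `q(K)` at `K`. -/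
theorem isTheDual_of_forall_iff {p q : Body n → E n} (hp : IsProperAffineInvariantPoint p)
    (hq : IsProperAffineInvariantPoint q)
    (h : ∀ (K : Body n) (x : E n) (hx : x ∈ interior K.set), p K = x ↔ q (K.polar x hx) = x) :
    IsTheDual p q := by
  refine ⟨⟨hp, hq.toIsAffineInvariantPoint, fun K => (h K _ _).1 rfl⟩, fun q' hq' => ?_⟩
  ext1 K
  have hx := hq.mem_interior K
  have hpL : p (K.polar (q K) hx) = q K :=
    (h _ _ (mem_interior_polar K hx)).2 (by rw [polar_polar])
  have := hq'.apply_polar (K.polar (q K) hx)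
  simp only [hpL] at this
  rwa [polar_polar] at this

end AffineInvariantPoints

end

open AffineInvariantPoints in
theorem mainTheorem8 (n : ℕ) :
    (∀ K : Body n, IsSantaloPoint K (santaloPoint K) ∧
      ∀ x : E n, IsSantaloPoint K x → x = santaloPoint K) ∧
    IsProperAffineInvariantPoint (santaloPoint : Body n → E n) ∧
    IsProperAffineInvariantPoint (centroid : Body n → E n) ∧
    IsTheDual (santaloPoint : Body n → E n) centroid ∧
    IsTheDual (centroid : Body n → E n) santaloPoint :=
  ⟨fun K => ⟨isSantaloPoint_santaloPoint K, fun _ hx => hx.eq_santaloPoint⟩,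
    isProper_santaloPoint, isProper_centroid,
    isTheDual_of_forall_iff isProper_santaloPoint isProper_centroid
      fun _ _ => santaloPoint_eq_iff_centroid_polar,
    isTheDual_of_forall_iff isProper_centroid isProper_santaloPoint
      fun _ _ => centroid_eq_iff_santaloPoint_polar⟩
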